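/- For a topological space $Z$ let $H_1^s(Z)$ denote its $1$-dimensional singular homology group with integer coefficients. Let $S^1$ be the circle and let $X$ be a metrisable topological space which is hereditarily equivalent to $S^1$ with respect to $H_1^s$; that is, suppose there exist a (not necessarily continuous) bijection $f : X \to S^1$ and, for every subspace $M \subseteq X$, a group isomorphism $f_*(M) : H_1^s(M) \to H_1^s(f(M))$, such that for all $N \subseteq M \subseteq X$ $$f_*(M)\circ (i_{N,M})_* = (i_{f(N),f(M)})_* \circ f_*(N),$$ where $i_{N,M} : N \hookrightarrow M$ and $i_{f(N),f(M)} : f(N) \hookrightarrow f(M)$ are the inclusions. Then $X$ is homeomorphic to $S^1$. -/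

import Mathlib

open CategoryTheory

universe u v

/-- The `n`-th singular homology group, with integer coefficients, of a subspace `M` of a
topological space `X`. (`ULift ℤ` is the group of integers in the universe of `X`.) -/
noncomputable def subspaceHomology (n : ℕ) {X : Type u} [TopologicalSpace X] (M : Set X) :
    AddCommGrpCat.{u} :=
  ((AlgebraicTopology.singularHomologyFunctor AddCommGrpCat.{u} n).obj
    (AddCommGrpCat.of (ULift.{u} ℤ))).obj (TopCat.of M)

/-- The homomorphism `H_n(N) → H_n(M)` induced by the inclusion of subspaces `N ⊆ M`. -/
noncomputable def subspaceHomologyMap (n : ℕ) {X : Type u} [TopologicalSpace X] {N M : Set X}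
    (h : N ⊆ M) : subspaceHomology n N →+ subspaceHomology n M :=
  (((AlgebraicTopology.singularHomologyFunctor AddCommGrpCat.{u} n).obj
    (AddCommGrpCat.of (ULift.{u} ℤ))).map
      (TopCat.ofHom ⟨Set.inclusion h, continuous_inclusion h⟩)).hom

/-- `f : X → Y` is a hereditary equivalence with respect to `n`-dimensional singular homology:
it is a (not necessarily continuous) bijection, and there are isomorphisms
`H_n(M) ≃ H_n(f(M))`, one for each subspace `M` of `X`, which commute with the homomorphisms
induced by inclusions of subspaces. -/
def IsHereditaryHomologyEquivalence (n : ℕ) {X : Type u} {Y : Type v} [TopologicalSpace X]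
    [TopologicalSpace Y] (f : X → Y) : Prop :=
  Function.Bijective f ∧
    ∃ e : ∀ M : Set X, subspaceHomology n M ≃+ subspaceHomology n (f '' M),
      ∀ (N M : Set X) (h : N ⊆ M) (a : subspaceHomology n N),
        e M (subspaceHomologyMap n h a) =
          subspaceHomologyMap n (Set.image_mono h : f '' N ⊆ f '' M) (e N a)

/-- `X` and `Y` are hereditarily equivalent with respect to `n`-dimensional singular
homology. -/
def HereditarilyHomologyEquivalent (n : ℕ) (X : Type u) (Y : Type v) [TopologicalSpace X]
    [TopologicalSpace Y] : Prop :=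
  ∃ f : X → Y, IsHereditaryHomologyEquivalence n f

/-!
The isomorphisms `H₁(M) ≃ H₁(f(M))` say in particular that `H₁(X) ≠ 0` while
`H₁(M) = 0` for every proper subspace `M` of `X`, because this is so for the circle. For the circle,
`H₁ ≠ 0` is detected by the winding-number cocycle
(`exists_circle_cocycle`, `pathClass_ne_zero_of_cocycle`), and a loop in a proper subspace factors
through a loop in the line (`pathClass_circle_subset_loop`). Homology is handled through the group
of singular 1-chains modulo boundaries: `H₁(Z) = 0` if and only if every loop in `Z` has class zero
there (`subsingleton_singularHomology_one_iff`).

So let `γ` be a loop in the metric space `X` with nonzero class. Any loop with nonzero class is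
surjective, since otherwise it would live in a proper subspace. Hence `X` is compact and locally
path-connected, and it follows that uniformly close loops are homologous: they differ by a sum of
small loops, which are not surjective (`exists_delta_pathClass_eq`). By the Arzelà–Ascoli theorem
the loops with nonzero class whose modulus of continuity is no worse than that of `γ` form a compact
set (`isCompact_essentialLoops`), so this set contains a loop `g` which is constant on as many
intervals as possible (`exists_maximal_constOn`).

If `g s = g t` with `s ≤ t`, then the class of `g` is the sum of the classes of the loop that makes
`g` constant on `[s, t]` and the loop that makes `g` constant outside `[s, t]`
(`pathClass_collapse_add_clampLoop`). One of the two is nonzero, so by maximality `g` is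
already constant on `[s, t]`, or on both `[0, s]` and `[t, 1]`. Contracting the intervals on which
`g` is constant, by means of a monotone function `F` that is constant on exactly these intervals
(`exists_monotone_parametrisation`), turns `g` into a homeomorphism from a circle onto `X`
(`nonempty_homeomorph_circle_of_loop`).
-/

open AlgebraicTopology Topology

/-! ### Singular chains -/

section SingularChains

open Simplicial

/-- The singular chain complex of `Z` with integer coefficients, in the form in which
`singularHomologyFunctor` uses it. -/
noncomputable abbrev singularChains (Z : TopCat.{u}) : ChainComplex AddCommGrpCat.{u} ℕ :=
  (TopCat.toSSet.obj Z).chainComplex (AddCommGrpCat.of (ULift.{u} ℤ))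

/-- The singular chain given by a single singular simplex `σ`, with coefficient one. -/
noncomputable def simplexChain {Z : TopCat.{u}} {n : ℕ} (σ : C(stdSimplex ℝ (Fin (n + 1)), Z)) :
    (singularChains Z).X n :=
  ((TopCat.toSSet.obj Z).ιChainComplex (R := AddCommGrpCat.of (ULift.{u} ℤ))
    ((Z.toSSetObjEquiv (.op ⦋n⦌)).symm σ)).hom ⟨1⟩

theorem singularChains_d_simplexChain {Z : TopCat.{u}} {n : ℕ}
    (σ : C(stdSimplex ℝ (Fin (n + 2)), Z)) :
    ((singularChains Z).d (n + 1) n).hom (simplexChain σ) =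
      ∑ i : Fin (n + 2), (-1 : ℤ) ^ i.val • simplexChain
        (σ.comp ⟨stdSimplex.map (S := ℝ) i.succAbove, stdSimplex.continuous_map _⟩) := by
  have := (TopCat.toSSet.obj Z).ιChainComplex_d (R := AddCommGrpCat.of (ULift.{u} ℤ))
    ((Z.toSSetObjEquiv (.op ⦋n + 1⦌)).symm σ)
  have := congrArg (fun f => f.hom ⟨1⟩) this
  simp only [AddCommGrpCat.hom_comp, AddMonoidHom.comp_apply] at this
  refine this.trans ?_
  have hsum := map_sum (AddCommGrpCat.homAddEquiv
    (M := AddCommGrpCat.of (ULift.{u} ℤ)) (N := (singularChains Z).X n))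
    (fun i : Fin (n + 2) => (-1 : ℤ) ^ i.val • (TopCat.toSSet.obj Z).ιChainComplex
      ((TopCat.toSSet.obj Z).δ i ((Z.toSSetObjEquiv (.op ⦋n + 1⦌)).symm σ))) Finset.univ
  refine (DFunLike.congr_fun hsum _).trans ?_
  rw [AddMonoidHom.finsetSum_apply]
  refine Finset.sum_congr rfl fun i _ => ?_
  rw [map_zsmul]
  rfl

theorem singularChains_hom_ext {Z : TopCat.{u}} {n : ℕ} {A : Type u} [AddCommGroup A]
    {f g : (singularChains Z).X n →+ A}
    (h : ∀ σ : C(stdSimplex ℝ (Fin (n + 1)), Z), f (simplexChain σ) = g (simplexChain σ)) :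
    f = g := by
  have : AddCommGrpCat.ofHom f = AddCommGrpCat.ofHom g := by
    refine SSet.chainComplex_hom_ext fun x => ?_
    ext ⟨k⟩
    have hx := h (Z.toSSetObjEquiv (.op ⦋n⦌) x)
    rw [simplexChain, Equiv.symm_apply_apply] at hx
    have hk : (⟨k⟩ : ULift.{u} ℤ) = k • ⟨1⟩ := by ext; simp
    rw [hk, map_zsmul, map_zsmul]
    exact congrArg (k • ·) hx
  exact congrArg AddCommGrpCat.Hom.hom this

/-- The homomorphism out of the `n`-chains with prescribed values on the singular simplices. -/
noncomputable def singularChainsDesc {Z : TopCat.{u}} {n : ℕ} {A : Type u} [AddCommGroup A]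
    (w : C(stdSimplex ℝ (Fin (n + 1)), Z) → A) : (singularChains Z).X n →+ A :=
  (Limits.Cofan.IsColimit.desc
    ((TopCat.toSSet.obj Z).isColimitChainComplexXCofan (AddCommGrpCat.of (ULift.{u} ℤ)) n)
    (fun x => AddCommGrpCat.ofHom (Y := A)
      ((zmultiplesHom A (w (Z.toSSetObjEquiv (.op ⦋n⦌) x))).comp
        (AddEquiv.ulift : ULift.{u} ℤ ≃+ ℤ).toAddMonoidHom))).hom

theorem singularChainsDesc_simplexChain {Z : TopCat.{u}} {n : ℕ} {A : Type u} [AddCommGroup A]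
    (w : C(stdSimplex ℝ (Fin (n + 1)), Z) → A) (σ : C(stdSimplex ℝ (Fin (n + 1)), Z)) :
    singularChainsDesc w (simplexChain σ) = w σ := by
  have := Limits.Cofan.IsColimit.fac
    ((TopCat.toSSet.obj Z).isColimitChainComplexXCofan (AddCommGrpCat.of (ULift.{u} ℤ)) n)
    (fun x => AddCommGrpCat.ofHom (Y := A)
      ((zmultiplesHom A (w (Z.toSSetObjEquiv (.op ⦋n⦌) x))).comp
        (AddEquiv.ulift : ULift.{u} ℤ ≃+ ℤ).toAddMonoidHom)) ((Z.toSSetObjEquiv (.op ⦋n⦌)).symm σ)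
  have := congrArg (fun f => f.hom ⟨1⟩) this
  refine this.trans ?_
  change (1 : ℤ) • w _ = w σ
  rw [one_smul, Equiv.apply_symm_apply]

theorem subsingleton_singularHomology_one_iff_exact {Z : TopCat.{u}} :
    Subsingleton (((singularHomologyFunctor AddCommGrpCat.{u} 1).obj
      (AddCommGrpCat.of (ULift.{u} ℤ))).obj Z) ↔
    ∀ z : (singularChains Z).X 1, ((singularChains Z).d 1 0).hom z = 0 →
      ∃ c, ((singularChains Z).d 2 1).hom c = z := by
  have h1 := (singularChains Z).exactAt_iff_isZero_homology 1
  rw [(singularChains Z).exactAt_iff' 2 1 0 (by simp) (by simp), ShortComplex.ab_exact_iff] at h1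
  rw [← AddCommGrpCat.isZero_iff_subsingleton]
  exact h1.symm

/-- The chain map induced by a continuous map. -/
noncomputable def singularChainsMap {Z W : TopCat.{u}} (f : Z ⟶ W) :
    singularChains Z ⟶ singularChains W :=
  SSet.chainComplexMap (TopCat.toSSet.map f) _

theorem singularChainsMap_simplexChain {Z W : TopCat.{u}} (f : Z ⟶ W) {n : ℕ}
    (σ : C(stdSimplex ℝ (Fin (n + 1)), Z)) :
    ((singularChainsMap f).f n).hom (simplexChain σ) = simplexChain (f.hom.comp σ) := by
  have := SSet.ι_chainComplexMap_f (f := TopCat.toSSet.map f) (R := AddCommGrpCat.of (ULift.{u} ℤ))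
    (x := (Z.toSSetObjEquiv (.op ⦋n⦌)).symm σ)
  exact congrArg (fun f => f.hom ⟨1⟩) this

end SingularChains

/-! ### One-chains modulo boundaries -/

section PathClasses

variable {Z W : Type u} [TopologicalSpace Z] [TopologicalSpace W]

/-- The group of singular 1-chains of `Z` modulo boundaries. It contains `H₁(Z)` as the subgroup of
classes of cycles, and every path, closed or not, has a class in it. -/
def PathClassGroup (Z : Type u) [TopologicalSpace Z] : Type u :=
  (singularChains (TopCat.of Z)).X 1 ⧸ ((singularChains (TopCat.of Z)).d 2 1).hom.range

noncomputable instance (Z : Type u) [TopologicalSpace Z] : AddCommGroup (PathClassGroup Z) :=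
  inferInstanceAs (AddCommGroup (_ ⧸ ((singularChains (TopCat.of Z)).d 2 1).hom.range))

/-- A path, regarded as a singular 1-simplex. -/
noncomputable def edgeSimplex (p : C(unitInterval, Z)) :
    C(stdSimplex ℝ (Fin (1 + 1)), TopCat.of Z) :=
  p.comp (stdSimplexHomeomorphUnitInterval : C(stdSimplex ℝ (Fin 2), unitInterval))

/-- The quotient map from the singular 1-chains to the 1-chains modulo boundaries. -/
noncomputable def toPathClassGroup (Z : Type u) [TopologicalSpace Z] :
    (singularChains (TopCat.of Z)).X 1 →+ PathClassGroup Z :=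
  QuotientAddGroup.mk' _

theorem toPathClassGroup_eq_zero_iff {z : (singularChains (TopCat.of Z)).X 1} :
    toPathClassGroup Z z = 0 ↔ ∃ c, ((singularChains (TopCat.of Z)).d 2 1).hom c = z :=
  QuotientAddGroup.eq_zero_iff z

/-- The class of a path in the group of 1-chains modulo boundaries. -/
noncomputable def pathClass (p : C(unitInterval, Z)) : PathClassGroup Z :=
  toPathClassGroup Z (simplexChain (edgeSimplex p))

/-- The composite of `r : E → Z` with the affine path from `a` to `b` in the vector space `E`. -/
noncomputable def segmentPath {E : Type*} [AddCommGroup E] [Module ℝ E] [TopologicalSpace E]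
    [ContinuousAdd E] [ContinuousSMul ℝ E] (r : C(E, Z)) (a b : E) : C(unitInterval, Z) :=
  r.comp ⟨fun t => (1 - (t : ℝ)) • a + (t : ℝ) • b, by fun_prop⟩

theorem segmentPath_apply {E : Type*} [AddCommGroup E] [Module ℝ E] [TopologicalSpace E]
    [ContinuousAdd E] [ContinuousSMul ℝ E] (r : C(E, Z)) (a b : E) (t : unitInterval) :
    segmentPath r a b t = r ((1 - (t : ℝ)) • a + (t : ℝ) • b) :=
  rfl

theorem edgeSimplex_surjective (σ : C(stdSimplex ℝ (Fin (1 + 1)), TopCat.of Z)) :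
    ∃ p : C(unitInterval, Z), edgeSimplex p = σ :=
  ⟨σ.comp (stdSimplexHomeomorphUnitInterval.symm : C(unitInterval, stdSimplex ℝ (Fin 2))), by
    ext x
    exact congrArg σ (stdSimplexHomeomorphUnitInterval.symm_apply_apply x)⟩

/-- The edge of a singular triangle `f` opposite to the vertex `i`, as a path. -/
noncomputable def triangleEdge (f : C(stdSimplex ℝ (Fin 3), Z)) (i : Fin 3) : C(unitInterval, Z) :=
  (f.comp ⟨stdSimplex.map (S := ℝ) i.succAbove, stdSimplex.continuous_map _⟩).comp
    (stdSimplexHomeomorphUnitInterval.symm : C(unitInterval, stdSimplex ℝ (Fin 2)))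

theorem triangleEdge_apply_zero (f : C(stdSimplex ℝ (Fin 3), Z)) (i : Fin 3) :
    triangleEdge f i 0 = f (stdSimplex.vertex (i.succAbove 0)) := by
  have : stdSimplexHomeomorphUnitInterval.symm 0 = stdSimplex.vertex (S := ℝ) (0 : Fin 2) :=
    stdSimplexHomeomorphUnitInterval.symm_apply_eq.2 rfl
  refine congrArg f ?_
  change stdSimplex.map _ (stdSimplexHomeomorphUnitInterval.symm 0) = _
  rw [this, stdSimplex.map_vertex]

theorem triangleEdge_apply_one (f : C(stdSimplex ℝ (Fin 3), Z)) (i : Fin 3) :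
    triangleEdge f i 1 = f (stdSimplex.vertex (i.succAbove 1)) := by
  have : stdSimplexHomeomorphUnitInterval.symm 1 = stdSimplex.vertex (S := ℝ) (1 : Fin 2) :=
    stdSimplexHomeomorphUnitInterval.symm_apply_eq.2 rfl
  refine congrArg f ?_
  change stdSimplex.map _ (stdSimplexHomeomorphUnitInterval.symm 1) = _
  rw [this, stdSimplex.map_vertex]

theorem edgeSimplex_triangleEdge (f : C(stdSimplex ℝ (Fin 3), Z)) (i : Fin 3) :
    edgeSimplex (triangleEdge f i) =
    f.comp ⟨stdSimplex.map (S := ℝ) i.succAbove, stdSimplex.continuous_map _⟩ := by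
  ext x
  exact congrArg (fun y => f (stdSimplex.map (S := ℝ) i.succAbove y))
    (stdSimplexHomeomorphUnitInterval.symm_apply_apply x)

theorem singularChains_d_triangle (f : C(stdSimplex ℝ (Fin 3), Z)) :
    ((singularChains (TopCat.of Z)).d 2 1).hom (simplexChain f) =
      simplexChain (edgeSimplex (triangleEdge f 0)) -
        simplexChain (edgeSimplex (triangleEdge f 1)) +
        simplexChain (edgeSimplex (triangleEdge f 2)) := by
  refine (singularChains_d_simplexChain (Z := TopCat.of Z) f).trans ?_
  rw [Fin.sum_univ_three, edgeSimplex_triangleEdge, edgeSimplex_triangleEdge,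
    edgeSimplex_triangleEdge]
  simp [sub_eq_add_neg]

theorem pathClass_triangleEdge (f : C(stdSimplex ℝ (Fin 3), Z)) :
    pathClass (triangleEdge f 0) - pathClass (triangleEdge f 1) +
      pathClass (triangleEdge f 2) = 0 := by
  unfold pathClass
  rw [← map_sub, ← map_add, toPathClassGroup_eq_zero_iff]
  exact ⟨_, singularChains_d_triangle f⟩

theorem stdSimplex_map_edge_apply (i : Fin 3) (t : unitInterval) (j : Fin 3) :
    (stdSimplex.map (S := ℝ) i.succAbove (stdSimplexHomeomorphUnitInterval.symm t)).1 j =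
      ∑ k : Fin 2, if i.succAbove k = j then ![1 - (t : ℝ), t] k else 0 := by
  refine (FunOnFinite.linearMap_apply_apply ℝ ℝ _ _ _).trans ?_
  rw [Finset.sum_filter]
  rfl

/-- The sides of an affine triangle in `E` add up under any continuous map out of `E`. With `E = ℝ`
this expresses concatenation of paths, and with `E = ℝ × ℝ` invariance under homotopy. -/
theorem pathClass_segmentPath_add {E : Type*} [AddCommGroup E] [Module ℝ E] [TopologicalSpace E]
    [ContinuousAdd E] [ContinuousSMul ℝ E] (r : C(E, Z)) (a b c : E) :
    pathClass (segmentPath r a b) + pathClass (segmentPath r b c) =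
      pathClass (segmentPath r a c) := by
  have hcont (i : Fin 3) : Continuous fun x : stdSimplex ℝ (Fin 3) => x.1 i :=
    (continuous_apply i).comp continuous_subtype_val
  let f : C(stdSimplex ℝ (Fin 3), Z) := r.comp ⟨fun x : stdSimplex ℝ (Fin 3) =>
    x.1 0 • a + x.1 1 • b + x.1 2 • c,
      (((hcont 0).smul continuous_const).add ((hcont 1).smul continuous_const)).add
        ((hcont 2).smul continuous_const)⟩
  have h := pathClass_triangleEdge f
  have e01 : (Fin.succAbove (0 : Fin 3) (0 : Fin 2)) = 1 := rfl
  have e02 : (Fin.succAbove (0 : Fin 3) (1 : Fin 2)) = 2 := rfl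
  have e11 : (Fin.succAbove (1 : Fin 3) (0 : Fin 2)) = 0 := rfl
  have e12 : (Fin.succAbove (1 : Fin 3) (1 : Fin 2)) = 2 := rfl
  have e21 : (Fin.succAbove (2 : Fin 3) (0 : Fin 2)) = 0 := rfl
  have e22 : (Fin.succAbove (2 : Fin 3) (1 : Fin 2)) = 1 := rfl
  have hface (i : Fin 3) (t : unitInterval) : triangleEdge f i t = r (∑ j : Fin 3,
      (∑ k : Fin 2, if i.succAbove k = j then ![1 - (t : ℝ), t] k else 0) • ![a, b, c] j) := by
    refine congrArg r ?_
    simp_rw [← stdSimplex_map_edge_apply, Fin.sum_univ_three]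
    rfl
  have h0 : triangleEdge f 0 = segmentPath r b c := by
    ext t
    rw [hface, Fin.sum_univ_three]
    simp only [Fin.sum_univ_two, e01, e02]
    simp [segmentPath]
  have h1 : triangleEdge f 1 = segmentPath r a c := by
    ext t
    rw [hface, Fin.sum_univ_three]
    simp only [Fin.sum_univ_two, e11, e12]
    simp [segmentPath]
  have h2 : triangleEdge f 2 = segmentPath r a b := by
    ext t
    rw [hface, Fin.sum_univ_three]
    simp only [Fin.sum_univ_two, e21, e22]
    simp [segmentPath]
  rw [h0, h1, h2] at h
  rw [← sub_eq_zero, ← h]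
  abel

theorem pathClass_segmentPath_self {E : Type*} [AddCommGroup E] [Module ℝ E] [TopologicalSpace E]
    [ContinuousAdd E] [ContinuousSMul ℝ E] (r : C(E, Z)) (a : E) :
      pathClass (segmentPath r a a) = 0 :=
  add_eq_right.1 (pathClass_segmentPath_add r a a a)

theorem pathClass_segmentPath_eq_zero_of_const {E : Type*} [AddCommGroup E] [Module ℝ E]
    [TopologicalSpace E] [ContinuousAdd E] [ContinuousSMul ℝ E] (r : C(E, Z)) (a b : E) (z : Z)
    (h : ∀ t : unitInterval, r ((1 - (t : ℝ)) • a + (t : ℝ) • b) = z) :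
    pathClass (segmentPath r a b) = 0 := by
  have : segmentPath r a b = segmentPath (ContinuousMap.const ℝ z) 0 0 := by
    ext t
    exact h t
  rw [this, pathClass_segmentPath_self]

/-- The extension of a path to the real line that is constant on both sides of the unit interval. -/
noncomputable def extendLine (p : C(unitInterval, Z)) : C(ℝ, Z) :=
  p.comp ⟨Set.projIcc 0 1 zero_le_one, continuous_projIcc⟩

theorem extendLine_coe (p : C(unitInterval, Z)) (t : unitInterval) : extendLine p t = p t :=
  congrArg p (Set.projIcc_val zero_le_one t)

theorem segmentPath_extendLine (p : C(unitInterval, Z)) : segmentPath (extendLine p) 0 1 = p := by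
  ext t
  refine Eq.trans ?_ (extendLine_coe p t)
  simp [segmentPath]

theorem extendLine_of_mem (g : C(unitInterval, Z)) {x : ℝ} (hx : x ∈ unitInterval) :
    extendLine g x = g ⟨x, hx⟩ := extendLine_coe g ⟨x, hx⟩

theorem pathClass_segmentPath_congr {r r' : C(ℝ, Z)} {a b : ℝ} (hab : a ≤ b)
    (h : ∀ x, a ≤ x → x ≤ b → r x = r' x) : pathClass (segmentPath r a b) =
      pathClass (segmentPath r' a b) := by
  congr 1
  ext t
  refine h ((1 - (t : ℝ)) • a + (t : ℝ) • b) ?_ ?_ <;> simp only [smul_eq_mul] <;>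
    nlinarith [t.2.1, t.2.2]

theorem pathClass_segmentPath_eq_zero {r : C(ℝ, Z)} {a b : ℝ} (hab : a ≤ b) (z : Z)
    (h : ∀ x, a ≤ x → x ≤ b → r x = z) : pathClass (segmentPath r a b) = 0 := by
  rw [pathClass_segmentPath_congr (r' := ContinuousMap.const _ z) hab h]
  exact pathClass_segmentPath_eq_zero_of_const _ _ _ z fun _ => rfl

theorem sum_pathClass_segmentPath {E : Type*} [AddCommGroup E] [Module ℝ E] [TopologicalSpace E]
    [ContinuousAdd E] [ContinuousSMul ℝ E] (r : C(E, Z)) (t : ℕ → E) (n : ℕ) :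
    ∑ i ∈ Finset.range n, pathClass (segmentPath r (t i) (t (i + 1))) =
      pathClass (segmentPath r (t 0) (t n)) := by
  induction n with
  | zero => simp [pathClass_segmentPath_self]
  | succ n ih => rw [Finset.sum_range_succ, ih, pathClass_segmentPath_add]

theorem pathClass_path_trans {x y z : Z} (p : Path x y) (q : Path y z) :
    pathClass (p.trans q : C(unitInterval, Z)) =
      pathClass (p : C(unitInterval, Z)) + pathClass (q : C(unitInterval, Z)) := by
  have h1 : segmentPath (extendLine (p.trans q : C(unitInterval, Z))) 0 (1 / 2) = p := by
    ext t
    have ht : (t : ℝ) / 2 ∈ Set.Icc (0 : ℝ) 1 := ⟨by linarith [t.2.1], by linarith [t.2.2]⟩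
    have ht' : (t : ℝ) / 2 ≤ 1 / 2 := by linarith [t.2.2]
    have he : (1 - (t : ℝ)) • (0 : ℝ) + (t : ℝ) • (1 / 2 : ℝ) =
      ((⟨t / 2, ht⟩ : unitInterval) : ℝ) := by simp; ring
    rw [segmentPath_apply, he, extendLine_coe]
    refine (Path.trans_apply p q _).trans ?_
    rw [dif_pos ht']
    exact congrArg (fun u => p u) (Subtype.ext (by simp; ring))
  have h2 : segmentPath (extendLine (p.trans q : C(unitInterval, Z))) (1 / 2) 1 = q := by
    ext t
    have ht : (1 + t : ℝ) / 2 ∈ Set.Icc (0 : ℝ) 1 := ⟨by linarith [t.2.1], by linarith [t.2.2]⟩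
    have he : (1 - (t : ℝ)) • (1 / 2 : ℝ) + (t : ℝ) • (1 : ℝ) =
      ((⟨(1 + t) / 2, ht⟩ : unitInterval) : ℝ) := by simp; ring
    rw [segmentPath_apply, he, extendLine_coe]
    refine (Path.trans_apply p q _).trans ?_
    split_ifs with h
    · have h0 : t = 0 := Subtype.ext (le_antisymm (by
        simp only [Set.Icc.coe_zero]; have : (1 + t : ℝ) / 2 ≤ 1 / 2 := h; linarith) t.2.1)
      subst h0
      exact Eq.trans (b := p 1) (congrArg (fun u => p u) (Subtype.ext (by simp)))
        (p.target.trans q.source.symm)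
    · exact congrArg (fun u => q u) (Subtype.ext (by simp; ring))
  rw [← segmentPath_extendLine (p.trans q : C(unitInterval, Z)),
    ← pathClass_segmentPath_add _ 0 (1 / 2) 1, h1, h2]

theorem pathClass_path_symm {x y : Z} (p : Path x y) :
    pathClass (p.symm : C(unitInterval, Z)) = - pathClass (p : C(unitInterval, Z)) := by
  have h1 : segmentPath (extendLine (p : C(unitInterval, Z))) 1 0 = p.symm := by
    ext t
    have he : (1 - (t : ℝ)) • (1 : ℝ) + (t : ℝ) • (0 : ℝ) =
      ((unitInterval.symm t : unitInterval) : ℝ) := by simp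
    rw [segmentPath_apply, he, extendLine_coe]
    rfl
  have h := pathClass_segmentPath_add (extendLine (p : C(unitInterval, Z))) 1 0 1
  rw [pathClass_segmentPath_self, h1, segmentPath_extendLine] at h
  exact eq_neg_of_add_eq_zero_left h

/-- Functoriality of the group of 1-chains modulo boundaries, as far as path classes are
concerned. -/
theorem exists_pathClassGroup_hom (f : C(Z, W)) :
    ∃ φ : PathClassGroup Z →+ PathClassGroup W,
      ∀ p : C(unitInterval, Z), φ (pathClass p) = pathClass (f.comp p) := by
  let F := singularChainsMap (TopCat.ofHom f)
  refine ⟨QuotientAddGroup.map _ _ (F.f 1).hom ?_, fun p => ?_⟩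
  · rintro _ ⟨c, rfl⟩
    refine ⟨(F.f 2).hom c, ?_⟩
    have := F.comm 2 1
    exact congrArg (fun g => g.hom c) this
  · refine (QuotientAddGroup.map_mk _ _ _ _ _).trans ?_
    exact congrArg (toPathClassGroup W) (singularChainsMap_simplexChain _ _)

/-- The singular 0-chain given by a point. -/
noncomputable def pointChain (z : Z) : (singularChains (TopCat.of Z)).X 0 :=
  simplexChain (n := 0) (Z := TopCat.of Z) (ContinuousMap.const _ z)

theorem singularChains_d_edgeSimplex (p : C(unitInterval, Z)) :
    ((singularChains (TopCat.of Z)).d 1 0).hom (simplexChain (edgeSimplex p)) =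
      pointChain (p 1) - pointChain (p 0) := by
  refine (singularChains_d_simplexChain (Z := TopCat.of Z) (edgeSimplex p)).trans ?_
  have h (i : Fin 2) (s : unitInterval) (hs : s = ![1, 0] i) : (edgeSimplex p).comp
      ⟨stdSimplex.map (S := ℝ) i.succAbove, stdSimplex.continuous_map _⟩ =
      ContinuousMap.const (stdSimplex ℝ (Fin 1)) (p s) := by
    ext x
    refine congrArg p (Subtype.ext ?_)
    refine (FunOnFinite.linearMap_apply_apply ℝ ℝ _ _ _).trans ?_
    rw [Finset.sum_filter, Fin.sum_univ_one]
    subst hs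
    fin_cases i <;> simp
  rw [Fin.sum_univ_two, h 0 1 rfl, h 1 0 rfl]
  simp [sub_eq_add_neg, pointChain]

/-- The group `H₁(Z)` vanishes as soon as all loops have class zero: join every point of `Z` to a
base point of its path component; then the class of any chain depends only on its boundary. -/
theorem subsingleton_singularHomology_one_iff :
    Subsingleton (((singularHomologyFunctor AddCommGrpCat.{u} 1).obj
      (AddCommGrpCat.of (ULift.{u} ℤ))).obj (TopCat.of Z)) ↔
    ∀ p : C(unitInterval, Z), p 0 = p 1 → pathClass p = 0 := by
  rw [subsingleton_singularHomology_one_iff_exact]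
  constructor
  · intro h p hp
    refine toPathClassGroup_eq_zero_iff.2 (h _ ?_)
    rw [singularChains_d_edgeSimplex, hp, sub_self]
  · intro h z hz
    rw [← toPathClassGroup_eq_zero_iff]
    -- `b x` is the base point of the path component of `x`.
    let b (x : Z) : Z := (Quotient.out (s := pathSetoid Z) ⟦x⟧)
    have hb (x : Z) : Nonempty (Path (b x) x) := Quotient.mk_out (s := pathSetoid Z) x
    let P (x : Z) : Path (b x) x := (hb x).some
    let c (x : Z) : PathClassGroup Z := pathClass (P x : C(unitInterval, Z))
    let Φ : (singularChains (TopCat.of Z)).X 0 →+ PathClassGroup Z :=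
      singularChainsDesc fun σ => c (σ default)
    have hΦ (x : Z) : Φ (pointChain x) = c x := singularChainsDesc_simplexChain _ _
    have key : toPathClassGroup Z = Φ.comp ((singularChains (TopCat.of Z)).d 1 0).hom := by
      refine singularChains_hom_ext fun σ => ?_
      obtain ⟨p, rfl⟩ := edgeSimplex_surjective σ
      rw [AddMonoidHom.comp_apply, singularChains_d_edgeSimplex, map_sub, hΦ, hΦ]
      have hbb : b (p 0) = b (p 1) := by
        have : (⟦p 0⟧ : Quotient (pathSetoid Z)) = ⟦p 1⟧ := Quotient.sound ⟨⟨p, rfl, rfl⟩⟩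
        exact congrArg Quotient.out this
      let q : Path (p 0) (p 1) := ⟨p, rfl, rfl⟩
      have hl := h (((P (p 0)).trans q).trans (P (p 1)).symm) (by simpa using hbb)
      rw [pathClass_path_trans, pathClass_path_trans, pathClass_path_symm] at hl
      have : c (p 0) + pathClass p + - c (p 1) = 0 := hl
      change pathClass p = _
      rw [← sub_eq_zero, ← this]
      abel
    rw [key, AddMonoidHom.comp_apply, hz, map_zero]

/-- If a function `w` on paths is additive on the boundary of every singular triangle, then a path
on which it does not vanish has nonzero class. -/
theorem pathClass_ne_zero_of_cocycle {A : Type u} [AddCommGroup A] (w : C(unitInterval, Z) → A)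
    (hw : ∀ f : C(stdSimplex ℝ (Fin 3), Z), w (triangleEdge f 0) - w (triangleEdge f 1) +
      w (triangleEdge f 2) = 0)
    {p : C(unitInterval, Z)} (hp : w p ≠ 0) : pathClass p ≠ 0 := by
  intro h
  obtain ⟨c, hc⟩ := toPathClassGroup_eq_zero_iff.1 h
  let Φ : (singularChains (TopCat.of Z)).X 1 →+ A :=
    singularChainsDesc fun σ => w (σ.comp
      (stdSimplexHomeomorphUnitInterval.symm : C(unitInterval, stdSimplex ℝ (Fin 2))))
  have hΦ (q : C(unitInterval, Z)) : Φ (simplexChain (edgeSimplex q)) = w q := by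
    refine (singularChainsDesc_simplexChain _ _).trans ?_
    congr 1
  have key : Φ.comp ((singularChains (TopCat.of Z)).d 2 1).hom = 0 := by
    refine singularChains_hom_ext fun σ => ?_
    refine (congrArg Φ (singularChains_d_triangle σ)).trans ?_
    rw [map_add, map_sub, hΦ, hΦ, hΦ]
    exact hw σ
  apply hp
  rw [← hΦ, ← hc]
  exact DFunLike.congr_fun key c

end PathClasses

/-! ### The circle and its proper subspaces -/

/-- The straight-line homotopy contracts a loop in the real line to its base point. -/
theorem pathClass_real_loop (p : C(unitInterval, ℝ)) (hp : p 0 = p 1) : pathClass p = 0 := by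
  -- On the unit square: constant for `x.1 = 0`, equal to `p` for `x.1 = 1`, and constant on the two
  -- remaining sides because `p` is a loop.
  let r : C(ℝ × ℝ, ℝ) :=
    ⟨fun x => p 0 + x.1 * (extendLine p x.2 - p 0), by fun_prop⟩
  have h0 : extendLine p 0 = p 0 := extendLine_coe p 0
  have h1 : extendLine p 1 = p 1 := extendLine_coe p 1
  have e : segmentPath r (1, 0) (1, 1) = p := by
    ext t
    have := extendLine_coe p t
    simp [segmentPath_apply, r, this]
  have a := pathClass_segmentPath_add r (1, 0) (0, 0) (1, 1)
  have b := pathClass_segmentPath_add r (0, 0) (0, 1) (1, 1)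
  rw [pathClass_segmentPath_eq_zero_of_const r (1, 0) (0, 0) (p 0) (by simp [r, h0]), zero_add, ← b,
    pathClass_segmentPath_eq_zero_of_const r (0, 0) (0, 1) (p 0) (by simp [r]), zero_add, e,
    pathClass_segmentPath_eq_zero_of_const r (0, 1) (1, 1) (p 0) (by simp [r, h1, hp])] at a
  exact a.symm

/-- A loop in a proper subspace `M` of the circle lifts to a loop in the line, since the lift of a
path whose ends differ by a nonzero multiple of `2π` would take every value on the circle. -/
theorem pathClass_circle_subset_loop {M : Set Circle} (hM : M ≠ Set.univ) (p : C(unitInterval, M))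
    (hp : p 0 = p 1) : pathClass p = 0 := by
  obtain ⟨z, hz⟩ := (Set.ne_univ_iff_exists_notMem M).1 hM
  obtain ⟨q, hq⟩ : ∃ q : C(unitInterval, ℝ), ∀ t, Circle.exp (q t) = (p t : Circle) := by
    obtain ⟨Γ, h⟩ := Circle.isCoveringMap_exp.exists_path_lifts
      (⟨fun t => (p t : Circle), by fun_prop⟩ : C(unitInterval, Circle))
      (Complex.arg (p 0 : Circle)) (Circle.exp_arg _).symm
    exact ⟨Γ, fun t => congrFun h.1 t⟩
  have hivt (s t : unitInterval) (x : ℝ) (h1 : q s ≤ x) (h2 : x ≤ q t) : Circle.exp x ∈ M := by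
    obtain ⟨u, rfl⟩ := mem_range_of_exists_le_of_exists_ge q.continuous ⟨s, h1⟩ ⟨t, h2⟩
    rw [hq]
    exact (p u).2
  -- If `q s < q t`, the interval `[q s, q t]` contains a full period and so an argument of `z`.
  have hle (s t : unitInterval) (h : Circle.exp (q s) = Circle.exp (q t)) : q t ≤ q s := by
    by_contra! hlt
    obtain ⟨n, hn⟩ := Circle.exp_eq_exp.1 h.symm
    have hn1 : (1 : ℤ) ≤ n := by
      by_contra! hn0
      have : (n : ℝ) ≤ 0 := by exact_mod_cast Int.lt_add_one_iff.1 hn0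
      nlinarith [Real.pi_pos]
    have hn2 : (1 : ℝ) ≤ n := by exact_mod_cast hn1
    have hmem := toIcoMod_mem_Ico Real.two_pi_pos (q s) (Complex.arg z)
    apply hz
    have he : Circle.exp (toIcoMod Real.two_pi_pos (q s) (Complex.arg z)) = z := by
      have := toIcoMod_add_toIcoDiv_zsmul Real.two_pi_pos (q s) (Complex.arg z)
      have h2 := Circle.exp_arg z
      rw [← this, Circle.exp_add] at h2
      simpa using h2
    rw [← he]
    refine hivt s t _ hmem.1 ?_
    nlinarith [hmem.2, Real.pi_pos]
  have hq01 : q 0 = q 1 := by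
    have : Circle.exp (q 0) = Circle.exp (q 1) := by rw [hq, hq, hp]
    exact le_antisymm (hle 1 0 this.symm) (hle 0 1 this)
  obtain ⟨a, -, ha⟩ := isCompact_univ.exists_isMinOn Set.univ_nonempty q.continuous.continuousOn
  obtain ⟨b, -, hb⟩ := isCompact_univ.exists_isMaxOn Set.univ_nonempty q.continuous.continuousOn
  have hab : q a ≤ q b := ha (Set.mem_univ b)
  -- the exponential map, extended from the range `[q a, q b]` of `q` by constants
  let e : C(ℝ, M) := ⟨fun x => ⟨Circle.exp (max (q a) (min (q b) x)),
    hivt a b _ (le_max_left _ _) (max_le hab (min_le_left _ _))⟩, by fun_prop⟩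
  obtain ⟨φ, hφ⟩ := exists_pathClassGroup_hom e
  have hpe : e.comp q = p := by
    ext t : 1
    refine Subtype.ext ?_
    have h1 : q a ≤ q t := ha (Set.mem_univ t)
    have h2 : q t ≤ q b := hb (Set.mem_univ t)
    change Circle.exp (max (q a) (min (q b) (q t))) = _
    rw [min_eq_right h2, max_eq_right h1, hq]
  rw [← hpe, ← hφ, pathClass_real_loop q hq01, map_zero]

/-- The winding of a path, that is, the difference of the end values of a lift to the line, is
additive on the boundary of every singular triangle, since triangles lift too; it does not vanish
on the loop that runs once around the circle. -/
theorem exists_circle_cocycle : ∃ w : C(unitInterval, Circle) → ℝ,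
    (∀ f : C(stdSimplex ℝ (Fin 3), Circle), w (triangleEdge f 0) - w (triangleEdge f 1) +
      w (triangleEdge f 2) = 0) ∧
    ∃ p, p 0 = p 1 ∧ w p ≠ 0 := by
  have hl (p : C(unitInterval, Circle)) :
      ∃ q : C(unitInterval, ℝ), ∀ t, Circle.exp (q t) = p t := by
    obtain ⟨Γ, h⟩ := Circle.isCoveringMap_exp.exists_path_lifts p (Complex.arg (p 0))
      (Circle.exp_arg _).symm
    exact ⟨Γ, fun t => congrFun h.1 t⟩
  choose q hq using hl
  have key (p : C(unitInterval, Circle)) (q' : C(unitInterval, ℝ))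
      (h : ∀ t, Circle.exp (q' t) = p t) : q p 1 - q p 0 = q' 1 - q' 0 := by
    have hc : Circle.exp (q p 0 - q' 0) = 1 := by
      rw [Circle.exp_sub, hq, h, div_self']
    have := Circle.isCoveringMap_exp.eq_of_comp_eq (g₁ := q p)
      (g₂ := fun t => q' t + (q p 0 - q' 0))
      (by fun_prop) (by fun_prop)
      (funext fun t => by simp [Circle.exp_add, hq, h, hc]) 0 (by simp)
    have := congrFun this 1
    beta_reduce at this
    linarith
  refine ⟨fun p => q p 1 - q p 0, fun f => ?_, ⟨fun t => Circle.exp (2 * Real.pi * t), by fun_prop⟩,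
    by simp, ?_⟩
  · have : LocallyPathConnectedSpace (stdSimplex ℝ (Fin 3)) :=
      (convex_stdSimplex ℝ (Fin 3)).locallyPathConnectedSpace
    have : ContractibleSpace (stdSimplex ℝ (Fin 3)) :=
      (convex_stdSimplex ℝ (Fin 3)).contractibleSpace Set.Nonempty.of_subtype
    obtain ⟨F, ⟨-, hF⟩, -⟩ := Circle.isCoveringMap_exp.existsUnique_continuousMap_lifts f
      (stdSimplex.vertex 0) (Complex.arg (f (stdSimplex.vertex 0))) (Circle.exp_arg _)
    have h (i : Fin 3) := key (triangleEdge f i) (triangleEdge F i) (fun t => congrFun hF _)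
    simp only [h, triangleEdge_apply_zero, triangleEdge_apply_one]
    have e01 : (Fin.succAbove (0 : Fin 3) (0 : Fin 2)) = 1 := rfl
    have e02 : (Fin.succAbove (0 : Fin 3) (1 : Fin 2)) = 2 := rfl
    have e11 : (Fin.succAbove (1 : Fin 3) (0 : Fin 2)) = 0 := rfl
    have e12 : (Fin.succAbove (1 : Fin 3) (1 : Fin 2)) = 2 := rfl
    have e21 : (Fin.succAbove (2 : Fin 3) (0 : Fin 2)) = 0 := rfl
    have e22 : (Fin.succAbove (2 : Fin 3) (1 : Fin 2)) = 1 := rfl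
    rw [e01, e02, e11, e12, e21, e22]
    ring
  · beta_reduce
    rw [key ⟨fun t => Circle.exp (2 * Real.pi * t), by fun_prop⟩
      ⟨fun t => 2 * Real.pi * t, by fun_prop⟩ (fun t => rfl)]
    simp [Real.pi_ne_zero]

/-! ### Loops that are injective up to intervals of constancy -/

section Parametrisation

variable {X : Type u} [MetricSpace X]

/-- The greatest distance from `g p` reached by `g` on `[p, t]`; it is zero when `t ≤ p`. -/
noncomputable def runningMax (g : C(unitInterval, X)) (p t : unitInterval) : ℝ :=
  sSup ((fun v => dist (g p) (g (max p (min v t)))) '' Set.univ)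

variable (g : C(unitInterval, X)) (p : unitInterval)

theorem continuous_runningMax : Continuous (runningMax g p) :=
  isCompact_univ.continuous_sSup (f := fun t v => dist (g p) (g (max p (min v t))))
    (by change Continuous fun x : unitInterval × unitInterval => _; fun_prop)

theorem bddAbove_runningMax (t : unitInterval) :
    BddAbove ((fun v => dist (g p) (g (max p (min v t)))) '' Set.univ) :=
  isCompact_univ.bddAbove_image (by fun_prop)

theorem le_runningMax {v t : unitInterval} (h1 : p ≤ v) (h2 : v ≤ t) :
    dist (g p) (g v) ≤ runningMax g p t :=
  le_csSup (bddAbove_runningMax g p t) ⟨v, trivial, by simp [min_eq_left h2, max_eq_right h1]⟩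

theorem runningMax_nonneg (t : unitInterval) : 0 ≤ runningMax g p t :=
  dist_nonneg.trans (le_csSup (bddAbove_runningMax g p t) ⟨p, trivial, rfl⟩)

theorem runningMax_le {t : unitInterval} {B : ℝ} (hB : 0 ≤ B)
    (h : ∀ v, p ≤ v → v ≤ t → dist (g p) (g v) ≤ B) : runningMax g p t ≤ B := by
  refine csSup_le (Set.univ_nonempty.image _) ?_
  rintro _ ⟨v, -, rfl⟩
  rcases le_total t p with htp | hpt
  · simpa [max_eq_left ((min_le_right v t).trans htp)] using hB
  · exact h _ (le_max_left _ _) (max_le hpt (min_le_right _ _))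

theorem runningMax_mono : Monotone (runningMax g p) := fun _ t hst =>
  runningMax_le g p (runningMax_nonneg g p t) fun _ h1 h2 => le_runningMax g p h1 (h2.trans hst)

theorem runningMax_eq_zero {t : unitInterval} (h : t ≤ p) : runningMax g p t = 0 :=
  le_antisymm (runningMax_le g p le_rfl fun v h1 h2 => by
    rw [le_antisymm (h2.trans h) h1, dist_self]) (runningMax_nonneg g p t)

/-- The path `g` is constant on the interval `[s, t]`. -/
def ConstOn (g : C(unitInterval, X)) (s t : unitInterval) : Prop :=
  ∀ v, s ≤ v → v ≤ t → g v = g s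

theorem runningMax_eq_of_constOn {s t : unitInterval} (hst : s ≤ t) (h : ConstOn g s t) :
    runningMax g p s = runningMax g p t := by
  refine le_antisymm (runningMax_mono g p hst)
    (runningMax_le g p (runningMax_nonneg g p s) fun v h1 h2 => ?_)
  rcases le_total v s with hvs | hsv
  · exact le_runningMax g p h1 hvs
  rcases le_total p s with hps | hsp
  · rw [h v hsv h2]
    exact le_runningMax g p hps le_rfl
  · rw [h v hsv h2, h p hsp (h1.trans h2), dist_self]
    exact runningMax_nonneg g p s

/-- For a path `g` in a compact space there is a continuous monotone function that is constant on
exactly those intervals on which `g` is constant: a weighted sum of the functions `runningMax g p`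
for `p` in a countable dense set. -/
theorem exists_monotone_parametrisation [CompactSpace X] :
    ∃ F : unitInterval → ℝ, Continuous F ∧ Monotone F ∧ F 0 = 0 ∧
    ∀ s t, s ≤ t → (F s = F t ↔ ConstOn g s t) := by
  let D := Metric.diam (Set.univ : Set X)
  let q := TopologicalSpace.denseSeq unitInterval
  let f : ℕ → unitInterval → ℝ := fun n t => (1 / 2) ^ n * runningMax g (q n) t
  have hpos (n : ℕ) : (0 : ℝ) < (1 / 2) ^ n := by positivity
  have hb (n : ℕ) (t : unitInterval) : ‖f n t‖ ≤ (1 / 2) ^ n * D := by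
    rw [Real.norm_of_nonneg (mul_nonneg (hpos n).le (runningMax_nonneg _ _ _))]
    refine mul_le_mul_of_nonneg_left ?_ (hpos n).le
    exact runningMax_le _ _ Metric.diam_nonneg fun v _ _ =>
      Metric.dist_le_diam_of_mem isCompact_univ.isBounded trivial trivial
  have hs : Summable fun n : ℕ => (1 / 2 : ℝ) ^ n * D := summable_geometric_two.mul_right D
  have hsf (t : unitInterval) : Summable fun n => f n t := .of_norm_bounded hs fun n => hb n t
  have hmono (n : ℕ) : Monotone (f n) := fun s t hst =>
    mul_le_mul_of_nonneg_left (runningMax_mono _ _ hst) (hpos n).le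
  refine ⟨fun t => ∑' n, f n t,
    continuous_tsum (fun n => (continuous_runningMax g (q n)).const_mul _) hs hb,
    fun s t hst => (hsf s).tsum_le_tsum (fun n => hmono n hst) (hsf t), ?_, fun s t hst => ⟨?_, ?_⟩⟩
  · simp [f, runningMax_eq_zero g _ unitInterval.nonneg']
  · intro heq v hsv hvt
    by_contra hne
    have hopen : IsOpen ({x | g x ≠ g v} ∩ Set.Ioo s v) :=
      (isOpen_ne_fun g.continuous continuous_const).inter isOpen_Ioo
    have hlt : s < v := lt_of_le_of_ne hsv (by rintro rfl; exact hne rfl)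
    -- `g` differs from `g v` at `s`, hence also at points slightly to the right of `s`.
    have hnon : ({x | g x ≠ g v} ∩ Set.Ioo s v).Nonempty := by
      have hcl : s ∈ closure (Set.Ioo s v) := by
        rw [closure_Ioo hlt.ne]
        exact Set.left_mem_Icc.2 hsv
      exact mem_closure_iff.1 hcl _ (isOpen_ne_fun g.continuous continuous_const) (Ne.symm hne)
    obtain ⟨n, hn1, hn2⟩ := (TopologicalSpace.denseRange_denseSeq unitInterval).exists_mem_open
      hopen hnon
    refine heq.not_lt ((hsf s).tsum_lt_tsum (fun k => hmono k hst) (i := n) ?_ (hsf t))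
    refine mul_lt_mul_of_pos_left ?_ (hpos n)
    rw [runningMax_eq_zero g (q n) hn2.1.le]
    exact (dist_pos.2 hn1).trans_le (le_runningMax g (q n) hn2.2.le hvt)
  · intro h
    exact tsum_congr fun n => congrArg ((1 / 2) ^ n * ·) (runningMax_eq_of_constOn g _ hst h)

/-- A surjective loop whose double points all come from intervals (of the circle) on which the loop
is constant descends to a homeomorphism from the circle obtained by contracting these intervals. -/
theorem nonempty_homeomorph_circle_of_loop [CompactSpace X] (hg : Function.Surjective g)
    (h01 : g 0 = g 1) (hne : ¬ ConstOn g 0 1)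
    (h : ∀ s t, s ≤ t → g s = g t → ConstOn g s t ∨ ConstOn g 0 s ∧ ConstOn g t 1) :
    Nonempty (X ≃ₜ Circle) := by
  obtain ⟨F, hF, hmono, hF0, hconst⟩ := exists_monotone_parametrisation g
  have hle (t : unitInterval) : F t ≤ F 1 := hmono unitInterval.le_one'
  have hge (t : unitInterval) : 0 ≤ F t := hF0 ▸ hmono unitInterval.nonneg'
  -- `F 1` is the circumference of the circle onto which the unit interval is wrapped by `F`.
  have hc : 0 < F 1 := lt_of_le_of_ne (hge 1) fun h =>
    hne ((hconst 0 1 zero_le_one).1 (hF0.trans h))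
  have : Fact (0 < F 1) := ⟨hc⟩
  let G : C(unitInterval, AddCircle (F 1)) := ⟨fun t => (F t : AddCircle (F 1)),
    (AddCircle.continuous_mk' (F 1)).comp hF⟩
  have hGs : Function.Surjective G := by
    intro z
    obtain ⟨x, hx, rfl⟩ : ∃ x ∈ Set.Ico (0 : ℝ) (0 + F 1), (x : AddCircle (F 1)) = z := by
      have := AddCircle.coe_image_Ico_eq (F 1) 0
      have hz : z ∈ (Set.univ : Set (AddCircle (F 1))) := trivial
      rw [← this] at hz
      exact hz
    obtain ⟨t, rfl⟩ := mem_range_of_exists_le_of_exists_ge hF ⟨0, hF0.trans_le hx.1⟩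
      ⟨1, by linarith [hx.2]⟩
    exact ⟨t, rfl⟩
  have hker (s t : unitInterval) : g s = g t ↔ G s = G t := by
    wlog hst : s ≤ t generalizing s t
    · rw [eq_comm, this t s (le_of_not_ge hst), eq_comm]
    constructor
    · intro hgst
      rcases h s t hst hgst with h | ⟨h1, h2⟩
      · exact congrArg (fun x : ℝ => (x : AddCircle (F 1))) ((hconst s t hst).2 h)
      · have e1 := (hconst 0 s unitInterval.nonneg').2 h1
        have e2 := (hconst t 1 unitInterval.le_one').2 h2
        change (F s : AddCircle (F 1)) = (F t : AddCircle (F 1))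
        rw [← e1, e2, hF0, AddCircle.coe_period, AddCircle.coe_zero]
    · intro hG
      obtain ⟨n, hn⟩ := (QuotientAddGroup.eq.1 hG : -F s + F t ∈ AddSubgroup.zmultiples (F 1))
      replace hn : (n : ℝ) * F 1 = -F s + F t := by simpa using hn
      have hst' := hmono hst
      have hn0 : (-1 : ℝ) < n := by nlinarith
      have hn1 : (n : ℝ) < 2 := by nlinarith [hge s, hle t]
      have hn0' : (-1 : ℤ) < n := by exact_mod_cast hn0
      have hn1' : n < (2 : ℤ) := by exact_mod_cast hn1
      obtain rfl | rfl : n = 0 ∨ n = 1 := by omega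
      · exact ((hconst s t hst).1 (by simp at hn; linarith) t hst le_rfl).symm
      · have e1 : F 0 = F s := by have := hge s; have := hle t; push_cast at hn; linarith
        have e2 : F t = F 1 := by have := hge s; have := hle t; push_cast at hn; linarith
        rw [(hconst 0 s unitInterval.nonneg').1 e1 s unitInterval.nonneg' le_rfl, h01]
        exact (hconst t 1 unitInterval.le_one').1 e2 1 unitInterval.le_one' le_rfl
  have hq : IsQuotientMap g := g.continuous.isClosedMap.isQuotientMap g.continuous hg
  let φ : C(X, AddCircle (F 1)) := hq.lift G fun s t hst => (hker s t).1 hst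
  have hφ (t : unitInterval) : φ (g t) = G t :=
    DFunLike.congr_fun (hq.lift_comp G fun s t hst => (hker s t).1 hst) t
  have hbij : Function.Bijective φ := by
    constructor
    · intro x y hxy
      obtain ⟨s, rfl⟩ := hg x
      obtain ⟨t, rfl⟩ := hg y
      rw [hφ, hφ] at hxy
      exact (hker s t).2 hxy
    · intro z
      obtain ⟨t, rfl⟩ := hGs z
      exact ⟨g t, hφ t⟩
  exact ⟨(Continuous.homeoOfEquivCompactToT2 (f := Equiv.ofBijective φ hbij) φ.continuous).trans
    (AddCircle.homeomorphCircle hc.ne')⟩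

end Parametrisation

/-! ### Uniformly close loops are homologous -/

section LoopSurgery

variable {X : Type u} [MetricSpace X]

/-- A compact locally path-connected metric space is uniformly locally path-connected. -/
theorem exists_delta_small_path [CompactSpace X] [LocallyPathConnectedSpace X] {ε : ℝ}
    (hε : 0 < ε) :
    ∃ δ > 0, ∀ a b : X, dist a b < δ → ∃ c : Path a b, ∀ t, dist (c t) a < ε := by
  have h (x : X) : ∃ s ∈ 𝓝 x, IsPathConnected s ∧ s ⊆ Metric.ball x (ε / 2) := by
    obtain ⟨s, ⟨h1, h2⟩, h3⟩ := (path_connected_basis x).mem_iff.1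
      (Metric.ball_mem_nhds x (half_pos hε))
    exact ⟨s, h1, h2, h3⟩
  choose s hs hsc hsb using h
  obtain ⟨δ, hδ, H⟩ := lebesgue_number_lemma_of_metric (isCompact_univ (X := X))
    (c := fun x => interior (s x)) (fun _ => isOpen_interior)
    (fun x _ => Set.mem_iUnion.2 ⟨x, mem_interior_iff_mem_nhds.2 (hs x)⟩)
  refine ⟨δ, hδ, fun a b hab => ?_⟩
  obtain ⟨x, hx⟩ := H a trivial
  have ha : a ∈ s x := interior_subset (hx (Metric.mem_ball_self hδ))
  have hb : b ∈ s x := interior_subset (hx (by rwa [Metric.mem_ball, dist_comm]))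
  obtain ⟨c, hc⟩ := (hsc x).joinedIn a ha b hb
  refine ⟨c, fun t => ?_⟩
  have h1 := Metric.mem_ball.1 (hsb x (hc t))
  have h2 := Metric.mem_ball.1 (hsb x ha)
  linarith [dist_triangle_right (c t) a x]

/-- If all loops that are not surjective have class zero, then uniformly close loops have the same
class. Both loops are cut into short pieces and corresponding division points are joined by short
paths; each of the resulting quadrilaterals is too small to be surjective. -/
theorem exists_delta_pathClass_eq [CompactSpace X] [LocallyPathConnectedSpace X] [Nontrivial X]
    (hP : ∀ p : C(unitInterval, X), p 0 = p 1 → Set.range p ≠ Set.univ → pathClass p = 0) :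
    ∃ δ > 0, ∀ α β : C(unitInterval, X), α 0 = α 1 → β 0 = β 1 → dist α β < δ →
      pathClass α = pathClass β := by
  obtain ⟨x, y, hxy⟩ := exists_pair_ne X
  -- A set of radius `4 * ε` misses one of the points `x`, `y`.
  obtain ⟨ε, hε, hε2⟩ : ∃ ε > 0, 8 * ε ≤ dist x y := ⟨dist x y / 8, by
    have := dist_pos.2 hxy; positivity, by linarith⟩
  have hsmall (z : X) (s : Set X) (hs : ∀ w ∈ s, dist w z < 4 * ε) : s ≠ Set.univ := by
    rintro rfl
    linarith [dist_triangle_right x y z, hs x trivial, hs y trivial]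
  obtain ⟨δ, hδ, H⟩ := exists_delta_small_path (X := X) hε
  -- The class of the short path is chosen as a function `C` of its ends, so that the choices at the
  -- parameters `0` and `1`, where both loops close up, agree.
  have H' (a b : X) : ∃ q : PathClassGroup X, dist a b < δ → ∃ c : Path a b,
      pathClass (c : C(unitInterval, X)) = q ∧ ∀ t, dist (c t) a < ε := by
    by_cases hab : dist a b < δ
    · obtain ⟨c, hc⟩ := H a b hab
      exact ⟨_, fun _ => ⟨c, rfl, hc⟩⟩
    · exact ⟨0, fun h => (hab h).elim⟩
  choose C hC using H'
  refine ⟨min δ ε, lt_min hδ hε, fun α β hα hβ hαβ => ?_⟩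
  have hd (x : ℝ) : dist (extendLine α x) (extendLine β x) < min δ ε :=
    (ContinuousMap.dist_apply_le_dist (f := α) (g := β) _).trans_lt hαβ
  obtain ⟨η, hη, hu⟩ := Metric.uniformContinuous_iff.1
    (CompactSpace.uniformContinuous_of_continuous α.continuous) ε hε
  have hu' (x y : ℝ) (h : dist x y < η) : dist (extendLine α x) (extendLine α y) < ε :=
    hu (((LipschitzWith.projIcc zero_le_one).dist_le_mul x y).trans_lt (by simpa using h))
  obtain ⟨N, hN⟩ := exists_nat_one_div_lt hη
  let t (i : ℕ) : ℝ := i * (1 / (N + 1))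
  have hN0 : (0 : ℝ) < 1 / (N + 1) := by positivity
  have key (i : ℕ) : pathClass (segmentPath (extendLine α) (t i) (t (i + 1))) -
      pathClass (segmentPath (extendLine β) (t i) (t (i + 1))) =
      C (extendLine α (t i)) (extendLine β (t i)) -
        C (extendLine α (t (i + 1))) (extendLine β (t (i + 1))) := by
    obtain ⟨c, hc1, hc2⟩ := hC _ _ ((hd (t i)).trans_le (min_le_left _ _))
    obtain ⟨c', hc1', hc2'⟩ := hC _ _ ((hd (t (i + 1))).trans_le (min_le_left _ _))
    let A : Path (extendLine α (t i)) (extendLine α (t (i + 1))) :=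
      ⟨segmentPath (extendLine α) (t i) (t (i + 1)), by simp [segmentPath_apply],
        by simp [segmentPath_apply]⟩
    let B : Path (extendLine β (t i)) (extendLine β (t (i + 1))) :=
      ⟨segmentPath (extendLine β) (t i) (t (i + 1)), by simp [segmentPath_apply],
        by simp [segmentPath_apply]⟩
    have hclose (s : unitInterval) :
        dist (t i) ((1 - (s : ℝ)) • t i + (s : ℝ) • t (i + 1)) < η := by
      have e : t i - ((1 - (s : ℝ)) • t i + (s : ℝ) • t (i + 1)) = - (s * (1 / (N + 1))) := by
        simp only [t, smul_eq_mul]; push_cast; ring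
      rw [Real.dist_eq, e, abs_neg, abs_of_nonneg (mul_nonneg s.2.1 hN0.le)]
      exact (mul_le_of_le_one_left hN0.le s.2.2).trans_lt hN
    have hA (s : unitInterval) : dist (A s) (extendLine α (t i)) < ε := by
      rw [dist_comm]; exact hu' _ _ (hclose s)
    have hB (s : unitInterval) : dist (B s) (extendLine α (t i)) < 2 * ε := by
      have h1 : dist (B s) (A s) < ε := by
        rw [dist_comm]; exact (hd _).trans_le (min_le_right _ _)
      linarith [dist_triangle (B s) (A s) (extendLine α (t i)), hA s]
    have hc3' (s : unitInterval) : dist (c' s) (extendLine α (t i)) < 2 * ε := by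
      have h1 := hA 1
      rw [A.target] at h1
      linarith [dist_triangle (c' s) (extendLine α (t (i + 1))) (extendLine α (t i)), hc2' s]
    have hloop := hP (((A.trans c').trans B.symm).trans c.symm) (by simp) (by
      refine hsmall (extendLine α (t i)) _ ?_
      intro w hw
      change w ∈ Set.range (((A.trans c').trans B.symm).trans c.symm) at hw
      rw [Path.trans_range, Path.trans_range, Path.trans_range, Path.symm_range,
        Path.symm_range] at hw
      rcases hw with ((⟨s, rfl⟩ | ⟨s, rfl⟩) | ⟨s, rfl⟩) | ⟨s, rfl⟩
      · linarith [hA s]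
      · linarith [hc3' s]
      · linarith [hB s]
      · linarith [hc2 s])
    rw [pathClass_path_trans, pathClass_path_trans, pathClass_path_trans, pathClass_path_symm,
      pathClass_path_symm, hc1, hc1'] at hloop
    change pathClass (A : C(unitInterval, X)) - pathClass (B : C(unitInterval, X)) = _
    rw [← sub_eq_zero, ← hloop]
    abel
  have hsum := Finset.sum_congr (rfl : Finset.range (N + 1) = _) fun i _ => key i
  have ht0 : t 0 = ((0 : unitInterval) : ℝ) := by simp [t]
  have ht1 : t (N + 1) = ((1 : unitInterval) : ℝ) := by
    simp only [t]; push_cast; field_simp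
  rw [Finset.sum_sub_distrib, sum_pathClass_segmentPath, sum_pathClass_segmentPath,
    Finset.sum_range_sub', ht0, ht1,
    extendLine_coe, extendLine_coe, extendLine_coe, extendLine_coe, hα, hβ, sub_self,
    sub_eq_zero, Set.Icc.coe_zero, Set.Icc.coe_one, segmentPath_extendLine,
    segmentPath_extendLine] at hsum
  exact hsum

/-! ### Splitting a loop at a double point -/

/-- The path that agrees with `g` outside `[s, t]` and is constant on `[s, t]`, where
`g s = g t`. -/
noncomputable def collapseLoop (g : C(unitInterval, X)) {s t : unitInterval} (hst : s ≤ t)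
    (h : g s = g t) : C(unitInterval, X) :=
  ⟨fun v => if v ≤ s then g v else g (max v t), by
    refine Continuous.if_le g.continuous (by fun_prop) continuous_id continuous_const ?_
    rintro _ rfl
    rw [max_eq_right hst, h]⟩

/-- The path that agrees with `g` on `[s, t]` and is constant on each of `[0, s]` and `[t, 1]`. -/
noncomputable def clampLoop (g : C(unitInterval, X)) (s t : unitInterval) : C(unitInterval, X) :=
  ⟨fun v => g (max s (min v t)), by fun_prop⟩

variable (g : C(unitInterval, X)) {s t : unitInterval} (hst : s ≤ t) (h : g s = g t)

theorem clampLoop_of_le {v : unitInterval} (hv : v ≤ s) : clampLoop g s t v = g s := by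
  change g (max s (min v t)) = _
  rw [max_eq_left ((min_le_left _ _).trans hv)]

theorem clampLoop_of_ge (hst : s ≤ t) {v : unitInterval} (hv : t ≤ v) :
    clampLoop g s t v = g t := by
  change g (max s (min v t)) = _
  rw [min_eq_right hv, max_eq_right hst]

theorem clampLoop_of_mem {v : unitInterval} (h1 : s ≤ v) (h2 : v ≤ t) :
    clampLoop g s t v = g v := by
  change g (max s (min v t)) = _
  rw [min_eq_left h2, max_eq_right h1]

theorem collapseLoop_of_le {v : unitInterval} (hv : v ≤ s) : collapseLoop g hst h v = g v :=
  if_pos hv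

theorem collapseLoop_of_ge {v : unitInterval} (hv : t ≤ v) : collapseLoop g hst h v = g v := by
  change (if v ≤ s then g v else g (max v t)) = _
  rw [max_eq_left hv, ite_self]

theorem collapseLoop_of_mem {v : unitInterval} (h1 : s ≤ v) (h2 : v ≤ t) :
    collapseLoop g hst h v = g s := by
  change (if v ≤ s then g v else g (max v t)) = _
  split_ifs with hv
  · rw [le_antisymm hv h1]
  · rw [max_eq_right h2, h]

/-- A loop is homologous to the sum of the two loops into which a double point splits it. -/
theorem pathClass_collapse_add_clampLoop :
    pathClass (collapseLoop g hst h) + pathClass (clampLoop g s t) = pathClass g := by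
  have hs := s.2
  have ht := t.2
  have hst' : (s : ℝ) ≤ t := hst
  have dec (p : C(unitInterval, X)) : pathClass p = pathClass (segmentPath (extendLine p) 0 s) +
      pathClass (segmentPath (extendLine p) s t) + pathClass (segmentPath (extendLine p) t 1) := by
    rw [pathClass_segmentPath_add, pathClass_segmentPath_add, segmentPath_extendLine]
  have hmem {x : ℝ} (h0 : 0 ≤ x) (h1 : x ≤ 1) : x ∈ unitInterval := ⟨h0, h1⟩
  have a1 : pathClass (segmentPath (extendLine (collapseLoop g hst h)) 0 s) =
      pathClass (segmentPath (extendLine g) 0 s) := pathClass_segmentPath_congr hs.1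
        fun x h0 h1 => by
    have hx := hmem h0 (h1.trans hs.2)
    rw [extendLine_of_mem _ hx, extendLine_of_mem _ hx, collapseLoop_of_le]
    exact h1
  have a2 : pathClass (segmentPath (extendLine (collapseLoop g hst h)) s t) = 0 :=
    pathClass_segmentPath_eq_zero hst' (g s) fun x h0 h1 => by
    have hx := hmem (hs.1.trans h0) (h1.trans ht.2)
    rw [extendLine_of_mem _ hx]
    exact collapseLoop_of_mem g hst h h0 h1
  have a3 : pathClass (segmentPath (extendLine (collapseLoop g hst h)) t 1) =
      pathClass (segmentPath (extendLine g) t 1) := pathClass_segmentPath_congr ht.2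
        fun x h0 h1 => by
    have hx := hmem (ht.1.trans h0) h1
    rw [extendLine_of_mem _ hx, extendLine_of_mem _ hx, collapseLoop_of_ge]
    exact h0
  have b1 : pathClass (segmentPath (extendLine (clampLoop g s t)) 0 s) = 0 :=
    pathClass_segmentPath_eq_zero hs.1 (g s) fun x h0 h1 => by
    have hx := hmem h0 (h1.trans hs.2)
    rw [extendLine_of_mem _ hx, clampLoop_of_le]
    exact h1
  have b2 : pathClass (segmentPath (extendLine (clampLoop g s t)) s t) =
      pathClass (segmentPath (extendLine g) s t) := pathClass_segmentPath_congr hst'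
        fun x h0 h1 => by
    have hx := hmem (hs.1.trans h0) (h1.trans ht.2)
    rw [extendLine_of_mem _ hx, extendLine_of_mem _ hx]
    exact clampLoop_of_mem g h0 h1
  have b3 : pathClass (segmentPath (extendLine (clampLoop g s t)) t 1) = 0 :=
    pathClass_segmentPath_eq_zero ht.2 (g t) fun x h0 h1 => by
    have hx := hmem (ht.1.trans h0) h1
    rw [extendLine_of_mem _ hx]
    exact clampLoop_of_ge g hst h0
  rw [dec (collapseLoop g hst h), dec (clampLoop g s t), dec g, a1, a2, a3, b1, b2, b3]
  abel

/-- Points at distance at most `δ` have images at distance at most `ε` under `g`. -/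
def HasModulusAt (g : C(unitInterval, X)) (δ ε : ℝ) : Prop :=
  ∀ u v, dist u v ≤ δ → dist (g u) (g v) ≤ ε

variable {g} {δ ε : ℝ}

theorem HasModulusAt.clampLoop (hg : HasModulusAt g δ ε) : HasModulusAt (clampLoop g s t) δ ε := by
  intro u v huv
  refine hg _ _ (le_trans ?_ huv)
  rw [Subtype.dist_eq, Subtype.dist_eq, Real.dist_eq, Real.dist_eq]
  have e (x : unitInterval) : ((max s (min x t) : unitInterval) : ℝ) = max (s : ℝ) (min x t) := rfl
  rw [e, e]
  refine (abs_max_sub_max_le_max _ _ _ _).trans ?_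
  refine max_le (by simp) ((abs_min_sub_min_le_max _ _ _ _).trans (by simp))

theorem HasModulusAt.collapseLoop (hg : HasModulusAt g δ ε) :
    HasModulusAt (collapseLoop g hst h) δ ε := by
  intro u v huv
  wlog huv' : u ≤ v generalizing u v
  · rw [dist_comm]
    exact this v u (by rwa [dist_comm]) (le_of_not_ge huv')
  rw [Subtype.dist_eq, Real.dist_eq, abs_sub_comm,
    abs_of_nonneg (sub_nonneg.2 (Subtype.coe_le_coe.2 huv'))] at huv
  have hm (x y : unitInterval) (hxy : x ≤ y) (h1 : (y : ℝ) - x ≤ v - u) : dist (g x) (g y) ≤ ε := by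
    refine hg _ _ ?_
    rw [Subtype.dist_eq, Real.dist_eq, abs_sub_comm,
      abs_of_nonneg (sub_nonneg.2 (Subtype.coe_le_coe.2 hxy))]
    exact h1.trans huv
  have hst' : (s : ℝ) ≤ t := hst
  have huv'' : (u : ℝ) ≤ v := huv'
  rcases le_total u s with hus | hsu
  · rw [collapseLoop_of_le g hst h hus]
    rcases le_total v s with hvs | hsv
    · rw [collapseLoop_of_le g hst h hvs]
      exact hm u v huv' le_rfl
    rcases le_total v t with hvt | htv
    · rw [collapseLoop_of_mem g hst h hsv hvt]
      have : (s : ℝ) ≤ v := hsv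
      exact hm u s hus (by linarith)
    · rw [collapseLoop_of_ge g hst h htv]
      exact hm u v huv' le_rfl
  · have hsu' : (s : ℝ) ≤ u := hsu
    rcases le_total u t with hut | htu
    · have hut' : (u : ℝ) ≤ t := hut
      rw [collapseLoop_of_mem g hst h hsu hut]
      rcases le_total v t with hvt | htv
      · rw [collapseLoop_of_mem g hst h (hsu.trans huv') hvt]
        exact hm u u le_rfl (by linarith) |>.trans' (by simp)
      · rw [collapseLoop_of_ge g hst h htv, h]
        exact hm t v htv (by linarith)
    · rw [collapseLoop_of_ge g hst h htu, collapseLoop_of_ge g hst h (htu.trans huv')]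
      exact hm u v huv' le_rfl

theorem ConstOn.clampLoop (hst : s ≤ t) (h : g s = g t) {a b : unitInterval} (hg : ConstOn g a b) :
    ConstOn (clampLoop g s t) a b := by
  intro v hav hvb
  rcases le_total v s with hvs | hsv
  · rw [clampLoop_of_le g hvs, clampLoop_of_le g (hav.trans hvs)]
  rcases le_total v t with hvt | htv
  · rw [clampLoop_of_mem g hsv hvt]
    rcases le_total a s with has | hsa
    · rw [clampLoop_of_le g has, hg v hav hvb, hg s has (hsv.trans hvb)]
    · rw [clampLoop_of_mem g hsa (hav.trans hvt), hg v hav hvb]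
  · rw [clampLoop_of_ge g hst htv]
    rcases le_total a s with has | hsa
    · rw [clampLoop_of_le g has, h]
    rcases le_total a t with hat | hta
    · rw [clampLoop_of_mem g hsa hat, hg t hat (htv.trans hvb)]
    · rw [clampLoop_of_ge g hst hta]

theorem ConstOn.collapseLoop {a b : unitInterval} (hg : ConstOn g a b) :
    ConstOn (collapseLoop g hst h) a b := by
  intro v hav hvb
  rcases le_total v s with hvs | hsv
  · rw [collapseLoop_of_le g hst h hvs, collapseLoop_of_le g hst h (hav.trans hvs), hg v hav hvb]
  rcases le_total v t with hvt | htv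
  · rw [collapseLoop_of_mem g hst h hsv hvt]
    rcases le_total a s with has | hsa
    · rw [collapseLoop_of_le g hst h has, hg s has (hsv.trans hvb)]
    · rw [collapseLoop_of_mem g hst h hsa (hav.trans hvt)]
  · rw [collapseLoop_of_ge g hst h htv]
    rcases le_total a s with has | hsa
    · rw [collapseLoop_of_le g hst h has, hg v hav hvb]
    rcases le_total a t with hat | hta
    · rw [collapseLoop_of_mem g hst h hsa hat, hg v hav hvb, h, hg t hat (htv.trans hvb)]
    · rw [collapseLoop_of_ge g hst h hta, hg v hav hvb]

end LoopSurgery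

/-! ### Essential loops constant on as many intervals as possible -/

section EssentialLoops

variable {X : Type u} [MetricSpace X]

theorem isClosed_hasModulusAt (δ ε : ℝ) :
    IsClosed {g : C(unitInterval, X) | HasModulusAt g δ ε} := by
  simp only [HasModulusAt, Set.ofPred_forall]
  refine isClosed_iInter fun u => isClosed_iInter fun v => isClosed_iInter fun _ => ?_
  exact isClosed_le (by fun_prop) continuous_const

/-- The loops with nonzero class whose modulus of continuity is no worse than that of `γ`. -/
def essentialLoops (γ : C(unitInterval, X)) : Set C(unitInterval, X) :=
  {g | g 0 = g 1 ∧ pathClass g ≠ 0 ∧ ∀ δ ε, HasModulusAt γ δ ε → HasModulusAt g δ ε}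

theorem isCompact_essentialLoops [CompactSpace X] [LocallyPathConnectedSpace X] [Nontrivial X]
    (hP : ∀ p : C(unitInterval, X), p 0 = p 1 → Set.range p ≠ Set.univ → pathClass p = 0)
    (γ : C(unitInterval, X)) : IsCompact (essentialLoops γ) := by
  have hclosed : IsClosed (essentialLoops γ) := by
    obtain ⟨δ, hδ, H⟩ := exists_delta_pathClass_eq hP
    refine isClosed_of_closure_subset fun g hg => ?_
    have h01 : IsClosed {g : C(unitInterval, X) | g 0 = g 1} :=
      isClosed_eq (by fun_prop) (by fun_prop)
    have hg01 : g 0 = g 1 := closure_minimal (fun g hg => hg.1) h01 hg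
    refine ⟨hg01, ?_, fun d e hde =>
      closure_minimal (fun g hg => hg.2.2 d e hde) (isClosed_hasModulusAt d e) hg⟩
    obtain ⟨g', hg', hd⟩ := Metric.mem_closure_iff.1 hg δ hδ
    rw [H g g' hg01 hg'.1 hd]
    exact hg'.2.1
  let E := ContinuousMap.isometryEquivBoundedOfCompact unitInterval X
  rw [← E.toHomeomorph.isCompact_image]
  refine BoundedContinuousFunction.arzela_ascoli₁ _
    (E.toHomeomorph.isClosed_image.2 hclosed) ?_
  refine fun x => Metric.equicontinuousAt_iff_pair.2 fun ε hε => ?_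
  obtain ⟨η, hη, hu⟩ := Metric.uniformContinuous_iff.1
    (CompactSpace.uniformContinuous_of_continuous γ.continuous) (ε / 2) (half_pos hε)
  refine ⟨Metric.ball x (η / 4), Metric.ball_mem_nhds x (by positivity), ?_⟩
  rintro u hu' v hv' ⟨_, ⟨g, hg, rfl⟩⟩
  have hm : HasModulusAt γ (η / 2) (ε / 2) := fun a b hab => (hu (by linarith)).le
  have : dist (g u) (g v) ≤ ε / 2 := hg.2.2 _ _ hm u v (by
    rw [Metric.mem_ball] at hu' hv'
    linarith [dist_triangle_right u v x])
  exact this.trans_lt (half_lt_self hε)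

/-- A nonempty compact set of paths contains a path which is constant on a maximal collection of
intervals: being constant on given intervals is a closed condition, so Zorn's lemma applies. -/
theorem exists_maximal_constOn {S : Set C(unitInterval, X)} (hS : IsCompact S) (hne : S.Nonempty) :
    ∃ g ∈ S, ∀ g' ∈ S, (∀ a b, ConstOn g a b → ConstOn g' a b) →
      ∀ a b, ConstOn g' a b → ConstOn g a b := by
  let r (g g' : S) : Prop := ∀ a b, ConstOn g.1 a b → ConstOn g'.1 a b
  have : Std.Refl r := ⟨fun _ _ _ h => h⟩
  have htrans {g₁ g₂ g₃ : S} (h : r g₁ g₂) (h' : r g₂ g₃) : r g₁ g₃ :=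
    fun a b hab => h' a b (h a b hab)
  have hrcl (g : S) : IsClosed {g' | r g g'} := by
    simp only [r, ConstOn, Set.ofPred_forall]
    refine isClosed_iInter fun a => isClosed_iInter fun b => isClosed_iInter fun _ =>
      isClosed_iInter fun v => isClosed_iInter fun _ => isClosed_iInter fun _ => ?_
    exact isClosed_eq (by fun_prop) (by fun_prop)
  have : CompactSpace S := isCompact_iff_compactSpace.1 hS
  obtain ⟨g, hg⟩ := exists_maximal_of_chains_bounded (r := r) (fun c (hc : IsChain r c) => by
    rcases c.eq_empty_or_nonempty with rfl | hcn
    · exact ⟨⟨_, hne.some_mem⟩, fun _ h => h.elim⟩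
    have : Nonempty c := hcn.to_subtype
    obtain ⟨ub, hub⟩ := IsCompact.nonempty_iInter_of_directed_nonempty_isCompact_isClosed
      (fun g : c => {g' | r g.1 g'}) (fun g₁ g₂ => by
        rcases hc.total g₁.2 g₂.2 with h | h
        · exact ⟨g₂, fun g' hg' => htrans h hg', fun g' hg' => hg'⟩
        · exact ⟨g₁, fun g' hg' => hg', fun g' hg' => htrans h hg'⟩)
      (fun g => ⟨g.1, fun _ _ h => h⟩) (fun g => (hrcl g.1).isCompact) (fun g => hrcl g.1)
    exact ⟨ub, fun a ha => Set.mem_iInter.1 hub ⟨a, ha⟩⟩) htrans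
  exact ⟨g.1, g.2, fun g' hg' h => hg ⟨g', hg'⟩ h⟩

/-- A metric space is a circle if some loop in it has nonzero class, but none that is not
surjective. -/
theorem nonempty_homeomorph_circle
    (hP : ∀ p : C(unitInterval, X), p 0 = p 1 → Set.range p ≠ Set.univ → pathClass p = 0)
    {γ : C(unitInterval, X)} (hγ : γ 0 = γ 1) (hγ0 : pathClass γ ≠ 0) :
    Nonempty (X ≃ₜ Circle) := by
  have hsurj (p : C(unitInterval, X)) (h : p 0 = p 1) (h0 : pathClass p ≠ 0) :
      Function.Surjective p := by
    by_contra hs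
    exact h0 (hP p h fun hr => hs (Set.range_eq_univ.1 hr))
  have hconst (p : C(unitInterval, X)) (h : ConstOn p 0 1) : pathClass p = 0 := by
    rw [← segmentPath_extendLine p]
    exact pathClass_segmentPath_eq_zero_of_const _ _ _ (p 0) fun t => h _ unitInterval.nonneg'
      unitInterval.le_one'
  have hγs := hsurj γ hγ hγ0
  have : CompactSpace X := ⟨by
    rw [← hγs.range_eq]; exact isCompact_range γ.continuous⟩
  have : LocallyPathConnectedSpace unitInterval := (convex_Icc (0 : ℝ) 1).locallyPathConnectedSpace
  have : LocallyPathConnectedSpace X :=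
    (γ.continuous.isClosedMap.isQuotientMap γ.continuous hγs).locallyPathConnectedSpace
  have : Nontrivial X := by
    by_contra hn
    rw [not_nontrivial_iff_subsingleton] at hn
    exact hγ0 (hconst γ fun v _ _ => Subsingleton.elim _ _)
  obtain ⟨g, ⟨hg, hg0, hgm⟩, hmax⟩ := exists_maximal_constOn (isCompact_essentialLoops hP γ)
    ⟨γ, hγ, hγ0, fun _ _ h => h⟩
  refine nonempty_homeomorph_circle_of_loop g (hsurj g hg hg0) hg (fun h => hg0 (hconst g h)) ?_
  intro s t hst h
  by_cases hc : pathClass (collapseLoop g hst h) = 0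
  · have hc' : pathClass (clampLoop g s t) ≠ 0 := by
      have hadd := pathClass_collapse_add_clampLoop g hst h
      rw [hc, zero_add] at hadd
      rwa [hadd]
    have hm := hmax (clampLoop g s t) ⟨?_, hc', fun δ ε hδε => (hgm δ ε hδε).clampLoop⟩
      (fun a b hab => hab.clampLoop hst h)
    · refine Or.inr ⟨hm 0 s fun v _ hv => ?_, hm t 1 fun v hv _ => ?_⟩
      · rw [clampLoop_of_le g hv, clampLoop_of_le g unitInterval.nonneg']
      · rw [clampLoop_of_ge g hst hv, clampLoop_of_ge g hst le_rfl]
    · rw [clampLoop_of_le g unitInterval.nonneg', clampLoop_of_ge g hst unitInterval.le_one', h]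
  · refine Or.inl (hmax (collapseLoop g hst h) ⟨?_, hc, fun δ ε hδε =>
      (hgm δ ε hδε).collapseLoop hst h⟩ (fun a b hab => hab.collapseLoop hst h) s t
      fun v h1 h2 => ?_)
    · rw [collapseLoop_of_le g hst h unitInterval.nonneg',
        collapseLoop_of_ge g hst h unitInterval.le_one', hg]
    · rw [collapseLoop_of_mem g hst h h1 h2, collapseLoop_of_mem g hst h le_rfl hst]

end EssentialLoops

/-! ### Spaces hereditarily equivalent to the circle -/

theorem mainTheorem1 (X : Type u) [TopologicalSpace X] [TopologicalSpace.MetrizableSpace X]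
    (hX : HereditarilyHomologyEquivalent 1 X Circle) : Nonempty (X ≃ₜ Circle) := by
  let := TopologicalSpace.metrizableSpaceMetric X
  obtain ⟨f, hf, e, -⟩ := hX
  have hP (p : C(unitInterval, X)) (hp : p 0 = p 1) (hr : Set.range p ≠ Set.univ) :
      pathClass p = 0 := by
    have hne : f '' Set.range p ≠ Set.univ := fun h => hr (hf.1.image_injective (by
      rw [h, Set.image_univ, hf.2.range_eq]))
    have h1 : Subsingleton (subspaceHomology 1 (f '' Set.range p)) :=
      subsingleton_singularHomology_one_iff.2 fun q hq => pathClass_circle_subset_loop hne q hq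
    have h2 : Subsingleton (subspaceHomology 1 (Set.range p)) := (e _).toEquiv.subsingleton
    obtain ⟨φ, hφ⟩ := exists_pathClassGroup_hom
      (⟨Subtype.val, continuous_subtype_val⟩ : C(Set.range p, X))
    let p' : C(unitInterval, Set.range p) := ⟨fun t => ⟨p t, t, rfl⟩, by fun_prop⟩
    have h3 : pathClass p' = 0 := subsingleton_singularHomology_one_iff.1 h2 p' (Subtype.ext hp)
    have h4 := hφ p'
    rw [h3, map_zero] at h4
    exact h4.symm
  obtain ⟨γ, hγ, hγ0⟩ : ∃ γ : C(unitInterval, X), γ 0 = γ 1 ∧ pathClass γ ≠ 0 := by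
    by_contra! hall
    have h1 : Subsingleton (subspaceHomology 1 (Set.univ : Set X)) := by
      refine subsingleton_singularHomology_one_iff.2 fun q hq => ?_
      obtain ⟨φ, hφ⟩ := exists_pathClassGroup_hom
        (⟨fun x => ⟨x, trivial⟩, by fun_prop⟩ : C(X, (Set.univ : Set X)))
      let q' : C(unitInterval, X) := ⟨fun t => q t, by fun_prop⟩
      have h4 := hφ q'
      rw [hall q' (congrArg Subtype.val hq), map_zero] at h4
      exact h4.symm
    have h2 : Subsingleton (subspaceHomology 1 (f '' Set.univ)) := (e _).symm.toEquiv.subsingleton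
    obtain ⟨w, hw, p, hp, hwp⟩ := exists_circle_cocycle
    have huniv : ∀ z, z ∈ f '' Set.univ := fun z => by
      rw [Set.image_univ, hf.2.range_eq]; trivial
    obtain ⟨φ, hφ⟩ := exists_pathClassGroup_hom
      (⟨Subtype.val, continuous_subtype_val⟩ : C(f '' Set.univ, Circle))
    let p' : C(unitInterval, f '' Set.univ) := ⟨fun t => ⟨p t, huniv _⟩, by fun_prop⟩
    have h3 : pathClass p' = 0 := subsingleton_singularHomology_one_iff.1 h2 p' (Subtype.ext hp)
    have h4 := hφ p'
    rw [h3, map_zero] at h4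
    exact pathClass_ne_zero_of_cocycle w hw hwp h4.symm
  exact nonempty_homeomorph_circle hP hγ hγ0
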